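/- Let $n,t\ge 0$ be integers with $t\le n/2$, and let $p\in\mathbb{R}[x_1,\dots,x_n]$ be a multilinear polynomial (degree at most $1$ in each variable) of total degree at most $t$. Let $$q(x_1,\dots,x_n)=\frac1{n!}\sum_{\pi\in S_n}p^2\bigl(x_{\pi(1)},\dots,x_{\pi(n)}\bigr)$$ be the symmetrization of $p^2$. Then there are univariate polynomials $p_0,p_1,\dots,p_t\in\mathbb{R}[s]$, where each $p_{t-j}$ ($0\le j\le t$) is a finite sum of squares of real polynomials each of degree at most $t-j$, such that for every $x\in\{-1,1\}^n$ $$q(x)=\sum_{j=0}^{t}p_{t-j}(|x|)\prod_{0\le i<j}(|x|-i)(n-|x|-i),$$ where $|x|$ denotes the number of indices $i$ with $x_i=-1$. -/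

import Mathlib

/-- A polynomial is multilinear if every variable occurs with degree at most one. -/
def IsMultilinearPoly {n : ℕ} (p : MvPolynomial (Fin n) ℝ) : Prop :=
  ∀ i : Fin n, p.degreeOf i ≤ 1

/-- The symmetrization of a polynomial: its average over all permutations of the variables. -/
noncomputable def symmetrization {n : ℕ} (f : MvPolynomial (Fin n) ℝ) :
    MvPolynomial (Fin n) ℝ :=
  (n.factorial : ℝ)⁻¹ • ∑ σ : Equiv.Perm (Fin n), MvPolynomial.rename σ f

/-- The number of coordinates of `x` that are equal to `-1`. -/
noncomputable def minusCount {n : ℕ} (x : Fin n → ℝ) : ℕ :=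
  (Finset.univ.filter (fun i : Fin n => x i = -1)).card

/-- `f` is a finite sum of squares of real univariate polynomials, each of degree at most `d`
(so that `f` itself has degree at most `2 * d`). -/
def IsSumOfSquaresOfDegreeLE (d : ℕ) (f : Polynomial ℝ) : Prop :=
  ∃ (m : ℕ) (g : Fin m → Polynomial ℝ), (∀ k, (g k).natDegree ≤ d) ∧ f = ∑ k, g k ^ 2

/-! Identify x with the set X of its negative coordinates. At |x| = k, the value of q is the average
of p² over the slice of k-element sets (`eval_symmetrization`). As a function of X, p splits into
harmonic homogeneous parts of degrees a ≤ t whose coefficients R_S, |S| = a, are polynomials in |X|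
of degree at most t - a. This comes from repeatedly splitting a coefficient family as harmonic plus
up-operator image: on a set of size k, a degree d + 1 sum whose coefficients are such an image is (k
- d) times a degree d sum (`exists_harmonic_expansion_homogeneousSum`). On a fixed slice the R_S(k)
are real numbers. Parts of different degree are orthogonal there, and the mean square of the degree
a part is a positive constant times (∑ R_S(k)²) ∏_{i<a} (k - i)(n - k - i)
(`IsHarmonicFamily.sum_homogeneousSum_sq`). Hence p_{t-a} is that constant times ∑ R_S². -/

open Finset in
/-- A family indexed by finite sets is harmonic if the sum over all one-element extensions of
any set vanishes. -/
def IsHarmonicFamily {n : ℕ} {M : Type*} [AddCommMonoid M] (c : Finset (Fin n) → M) : Prop :=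
  ∀ T : Finset (Fin n), ∑ i ∈ Tᶜ, c (insert i T) = 0

open Finset in
/-- The value at the indicator vector of `X` of the homogeneous part of degree `a` of the
multilinear polynomial with coefficients `c`. -/
def homogeneousSum {n : ℕ} (c : Finset (Fin n) → ℝ) (a : ℕ) (X : Finset (Fin n)) : ℝ :=
  ∑ S ∈ powersetCard a X, c S

/-! ### Reindexing and the up-operator on harmonic functions -/

open Finset in
theorem sum_powersetCard_succ_sum_mem {α M : Type*} [DecidableEq α] [AddCommMonoid M]
    (X : Finset α) (a : ℕ) (f : Finset α → α → M) :
    ∑ S ∈ powersetCard (a + 1) X, ∑ i ∈ S, f S i =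
      ∑ U ∈ powersetCard a X, ∑ i ∈ X \ U, f (insert i U) i := by
  rw [sum_sigma', sum_sigma']
  refine sum_bij' (fun p _ => ⟨p.1.erase p.2, p.2⟩) (fun p _ => ⟨insert p.2 p.1, p.2⟩)
    ?_ ?_ ?_ ?_ ?_
  · rintro ⟨S, i⟩ h
    simp only [mem_sigma, mem_powersetCard, mem_sdiff] at h ⊢
    refine ⟨⟨(erase_subset _ _).trans h.1.1, ?_⟩, h.1.1 h.2, by simp⟩
    rw [card_erase_of_mem h.2, h.1.2]; rfl
  · rintro ⟨U, i⟩ h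
    simp only [mem_sigma, mem_powersetCard, mem_sdiff] at h ⊢
    refine ⟨⟨insert_subset h.2.1 h.1.1, ?_⟩, by simp⟩
    rw [card_insert_of_notMem h.2.2, h.1.2]
  · rintro ⟨S, i⟩ h
    simp only [mem_sigma] at h
    simp [insert_erase h.2]
  · rintro ⟨U, i⟩ h
    simp only [mem_sigma, mem_sdiff] at h
    simp [erase_insert h.2.2]
  · rintro ⟨S, i⟩ h
    simp only [mem_sigma] at h
    simp [insert_erase h.2]

open Finset in
theorem sum_sum_mem_eq_sum_sum_compl {α M : Type*} [Fintype α] [DecidableEq α] [AddCommMonoid M]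
    (f : Finset α → α → M) :
    ∑ S : Finset α, ∑ i ∈ S, f S i = ∑ U : Finset α, ∑ i ∈ Uᶜ, f (insert i U) i := by
  rw [sum_sigma', sum_sigma']
  refine sum_bij' (fun p _ => ⟨p.1.erase p.2, p.2⟩) (fun p _ => ⟨insert p.2 p.1, p.2⟩)
    ?_ ?_ ?_ ?_ ?_
  · rintro ⟨S, i⟩ h
    simp
  · rintro ⟨U, i⟩ h
    simp
  · rintro ⟨S, i⟩ h
    simp only [mem_sigma] at h
    simp [insert_erase h.2]
  · rintro ⟨U, i⟩ h
    simp only [mem_sigma, mem_compl] at h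
    simp [erase_insert h.2]
  · rintro ⟨S, i⟩ h
    simp only [mem_sigma] at h
    simp [insert_erase h.2]

open Finset in
theorem homogeneousSum_of_card_eq {n : ℕ} (c : Finset (Fin n) → ℝ) (T : Finset (Fin n)) :
    homogeneousSum c T.card T = c T := by
  simp [homogeneousSum]

open Finset in
theorem homogeneousSum_of_card_lt {n a : ℕ} (c : Finset (Fin n) → ℝ) {T : Finset (Fin n)}
    (h : T.card < a) : homogeneousSum c a T = 0 := by
  simp [homogeneousSum, powersetCard_eq_empty.2 h]

open Finset in
/-- The up-operator acts on a harmonic homogeneous function as multiplication by a scalar. -/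
theorem IsHarmonicFamily.sum_homogeneousSum_insert {n : ℕ} {c : Finset (Fin n) → ℝ}
    (hc : IsHarmonicFamily c) (a : ℕ) (T : Finset (Fin n)) :
    ∑ i ∈ Tᶜ, homogeneousSum c a (insert i T) =
      ((n : ℝ) - a - T.card) * homogeneousSum c a T := by
  have hcard : ((Tᶜ.card : ℕ) : ℝ) = n - T.card := by
    rw [card_compl, Fintype.card_fin, Nat.cast_sub (by simpa using card_le_univ T)]
  cases a with
  | zero => simp [homogeneousSum, hcard]
  | succ a =>
    have h1 : ∀ i ∈ Tᶜ, homogeneousSum c (a + 1) (insert i T) =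
        homogeneousSum c (a + 1) T + ∑ U ∈ powersetCard a T, c (insert i U) := by
      intro i hi
      have hiT : i ∉ T := by simpa using hi
      unfold homogeneousSum
      rw [powersetCard_succ_insert hiT, sum_union, sum_image]
      · intro U hU V hV hUV
        have hU' : i ∉ U := fun h => hiT ((mem_powersetCard.1 hU).1 h)
        have hV' : i ∉ V := fun h => hiT ((mem_powersetCard.1 hV).1 h)
        have := congrArg (fun s => erase s i) hUV
        simpa [erase_insert hU', erase_insert hV'] using this
      · rw [disjoint_left]
        intro S hS hS'
        obtain ⟨U, -, rfl⟩ := mem_image.1 hS'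
        exact hiT ((mem_powersetCard.1 hS).1 (mem_insert_self _ _))
    -- Harmonicity at U trades the extensions of U by points outside T for those by points of T.
    have h2 : ∀ U ∈ powersetCard a T,
        ∑ i ∈ Tᶜ, c (insert i U) = - ∑ i ∈ T \ U, c (insert i U) := by
      intro U hU
      have hUT := (mem_powersetCard.1 hU).1
      have h := hc U
      have hsplit : Uᶜ = Tᶜ ∪ (T \ U) := by
        ext i
        have := @hUT i
        simp only [mem_compl, mem_union, mem_sdiff]
        tauto
      rw [hsplit, sum_union] at h
      · linarith
      · rw [disjoint_left]
        intro i hi hi'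
        simp only [mem_compl, mem_sdiff] at hi hi'
        exact hi hi'.1
    -- Each (a + 1)-subset S of T arises from a + 1 pairs (U, i), which lowers the scalar from n -
    -- |T| to n - (a + 1) - |T|.
    have h3 := sum_powersetCard_succ_sum_mem T a (fun S _ => c S)
    have h4 : ∑ S ∈ powersetCard (a + 1) T, ∑ _i ∈ S, c S =
        (a + 1) * homogeneousSum c (a + 1) T := by
      unfold homogeneousSum
      rw [mul_sum]
      refine sum_congr rfl fun S hS => ?_
      rw [sum_const, (mem_powersetCard.1 hS).2]
      simp
    rw [sum_congr rfl h1, sum_add_distrib, sum_comm, sum_congr rfl h2, sum_neg_distrib, ← h3, h4,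
      sum_const, nsmul_eq_mul, hcard]
    push_cast
    ring

open Finset in
-- Iterating the up-operator m times multiplies its scalars, while each X is reached from T by m!
-- chains of one-point extensions.
theorem IsHarmonicFamily.factorial_mul_sum_homogeneousSum {n : ℕ} {c : Finset (Fin n) → ℝ}
    (hc : IsHarmonicFamily c) (a m : ℕ) (T : Finset (Fin n)) :
    (m.factorial : ℝ) * ∑ X ∈ powersetCard (T.card + m) univ with T ⊆ X, homogeneousSum c a X =
      (∏ i ∈ range m, ((n : ℝ) - a - T.card - i)) * homogeneousSum c a T := by
  induction m generalizing T with
  | zero =>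
    have : (powersetCard (T.card + 0) univ).filter (T ⊆ ·) = {T} := by
      ext X
      simp only [mem_filter, mem_powersetCard, subset_univ, true_and, mem_singleton, add_zero]
      constructor
      · rintro ⟨h1, h2⟩
        exact (eq_of_subset_of_card_le h2 h1.le).symm
      · rintro rfl
        exact ⟨rfl, Subset.rfl⟩
    rw [this]
    simp
  | succ m ih =>
    have key : ((m : ℝ) + 1) *
        ∑ X ∈ powersetCard (T.card + (m + 1)) univ with T ⊆ X, homogeneousSum c a X =
        ∑ i ∈ Tᶜ, ∑ X ∈ powersetCard ((insert i T).card + m) univ with insert i T ⊆ X,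
          homogeneousSum c a X := by
      have e : ∀ i ∈ Tᶜ, (powersetCard ((insert i T).card + m) univ).filter (insert i T ⊆ ·) =
          ((powersetCard (T.card + (m + 1)) univ).filter (T ⊆ ·)).filter (i ∈ ·) := by
        intro i hi
        rw [card_insert_of_notMem (by simpa using hi)]
        ext X
        simp only [mem_filter, mem_powersetCard, insert_subset_iff, add_assoc, add_comm 1 m]
        tauto
      have e' : ∀ i ∈ Tᶜ, ∑ X ∈ powersetCard ((insert i T).card + m) univ with insert i T ⊆ X,
          homogeneousSum c a X = ∑ X ∈ powersetCard (T.card + (m + 1)) univ with T ⊆ X,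
            if i ∈ X then homogeneousSum c a X else 0 := by
        intro i hi
        rw [e i hi, sum_filter (i ∈ ·)]
      rw [sum_congr rfl e', sum_comm, mul_sum]
      refine sum_congr rfl fun X hX => ?_
      simp only [mem_filter, mem_powersetCard, subset_univ, true_and] at hX
      rw [← sum_filter, sum_const, nsmul_eq_mul]
      congr 1
      have : Tᶜ.filter (· ∈ X) = X \ T := by
        ext i; simp [and_comm]
      rw [this, card_sdiff_of_subset hX.2, hX.1]
      simp
    have hT : ∀ i ∈ Tᶜ, ((insert i T).card : ℝ) = T.card + 1 := by
      intro i hi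
      rw [card_insert_of_notMem (by simpa using hi)]
      push_cast; rfl
    rw [Nat.factorial_succ]
    push_cast
    rw [mul_comm ((m : ℝ) + 1), mul_assoc, key, mul_sum, sum_congr rfl fun i hi => ih (insert i T)]
    rw [sum_congr rfl fun i hi => by rw [hT i hi], ← mul_sum, hc.sum_homogeneousSum_insert,
      prod_range_succ']
    rw [← mul_assoc]
    congr 1
    congr 1
    · refine prod_congr rfl fun i _ => ?_
      push_cast; ring
    · simp

/-! ### Orthogonality and norms on a slice -/

open Finset in
-- Expanding the second factor over b-sets T and exchanging the sums leaves, for each T, a sum over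
-- the supersets of T, where the iterated up-operator applies.
theorem IsHarmonicFamily.sum_homogeneousSum_mul_of_le {n : ℕ} {c : Finset (Fin n) → ℝ}
    (hc : IsHarmonicFamily c) (d : Finset (Fin n) → ℝ) {a b : ℕ} (hab : b ≤ a) (m : ℕ) :
    (m.factorial : ℝ) * ∑ X ∈ powersetCard (b + m) univ,
        homogeneousSum c a X * homogeneousSum d b X =
      (∏ i ∈ range m, ((n : ℝ) - a - b - i)) *
        ∑ T ∈ powersetCard b univ, d T * homogeneousSum c a T := by
  have h : ∑ X ∈ powersetCard (b + m) univ, homogeneousSum c a X * homogeneousSum d b X =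
      ∑ T ∈ powersetCard b univ,
        d T * ∑ X ∈ powersetCard (b + m) univ with T ⊆ X, homogeneousSum c a X := by
    simp_rw [mul_sum, sum_filter]
    rw [sum_comm]
    refine sum_congr rfl fun X _ => ?_
    have : powersetCard b X = (powersetCard b univ).filter (· ⊆ X) := by
      ext T
      simp only [mem_filter, mem_powersetCard, subset_univ, true_and]
      tauto
    conv_lhs => rw [homogeneousSum.eq_1 d, this, mul_sum]
    rw [sum_filter]
    refine sum_congr rfl fun T _ => ?_
    split_ifs
    · ring
    · rfl
  rw [h, mul_sum, mul_sum]
  refine sum_congr rfl fun T hT => ?_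
  obtain rfl := (mem_powersetCard.1 hT).2
  rw [mul_left_comm, hc.factorial_mul_sum_homogeneousSum]
  ring

open Finset in
-- For b < a the pairing reduces to values of the degree a part at b-sets, which contain no
-- a-subset.
theorem IsHarmonicFamily.sum_homogeneousSum_mul_of_ne {n : ℕ} {c : Finset (Fin n) → ℝ}
    (hc : IsHarmonicFamily c) {a b : ℕ} (hab : a ≠ b) (k : ℕ) :
    ∑ X ∈ powersetCard k univ, homogeneousSum c a X * homogeneousSum c b X = 0 := by
  wlog h : b < a generalizing a b
  · rw [← this hab.symm (by omega)]
    exact sum_congr rfl fun X _ => mul_comm _ _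
  by_cases hk : b ≤ k
  · obtain ⟨m, rfl⟩ := Nat.exists_eq_add_of_le hk
    have h1 := hc.sum_homogeneousSum_mul_of_le c h.le m
    have h2 : ∑ T ∈ powersetCard b univ, c T * homogeneousSum c a T = 0 :=
      sum_eq_zero fun T hT => by
        rw [homogeneousSum_of_card_lt c ((mem_powersetCard.1 hT).2.trans_lt h), mul_zero]
    rw [h2, mul_zero] at h1
    exact (mul_eq_zero.1 h1).resolve_left (by positivity)
  · refine sum_eq_zero fun X hX => ?_
    rw [homogeneousSum_of_card_lt c (a := b) (by rw [(mem_powersetCard.1 hX).2]; omega), mul_zero]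

theorem prod_range_cast_sub_eq_descFactorial (N m : ℕ) :
    ∏ i ∈ Finset.range m, ((N : ℝ) - i) = N.descFactorial m := by
  rw [← descPochhammer_eval_eq_prod_range, descPochhammer_eval_eq_descFactorial]

theorem factorial_sub_mul_descFactorial {n a m : ℕ} (ha : 2 * a ≤ n) (hm : a + m ≤ n) :
    (n - (a + m)).factorial * (n - 2 * a).descFactorial m =
      (n - 2 * a).factorial * (n - (a + m)).descFactorial a := by
  by_cases h : m ≤ n - 2 * a
  · rw [← Nat.factorial_mul_descFactorial h,
      ← Nat.factorial_mul_descFactorial (show a ≤ n - (a + m) by omega),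
      show n - 2 * a - m = n - (a + m) - a by omega]
    ring
  · rw [Nat.descFactorial_of_lt (by omega), Nat.descFactorial_of_lt (by omega)]
    simp

open Finset in
-- This is the pairing with a = b: at an a-set the degree a part is just its coefficient, and
-- factorial identities turn the scalar into the stated product. The bound 2a ≤ n keeps the falling
-- factorial nonzero.
theorem IsHarmonicFamily.sum_homogeneousSum_sq {n : ℕ} {c : Finset (Fin n) → ℝ}
    (hc : IsHarmonicFamily c) {a k : ℕ} (ha : 2 * a ≤ n) (hk : k ≤ n) :
    (n.choose k : ℝ)⁻¹ * ∑ X ∈ powersetCard k univ, homogeneousSum c a X ^ 2 =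
      ((n.descFactorial (2 * a) : ℝ)⁻¹ * ∑ S ∈ powersetCard a univ, c S ^ 2) *
        ∏ i ∈ range a, (((k : ℝ) - i) * ((n : ℝ) - k - i)) := by
  by_cases hak : a ≤ k
  · obtain ⟨m, rfl⟩ := Nat.exists_eq_add_of_le hak
    have h1 := hc.sum_homogeneousSum_mul_of_le c le_rfl m (a := a)
    have h2 : ∑ T ∈ powersetCard a univ, c T * homogeneousSum c a T =
        ∑ S ∈ powersetCard a univ, c S ^ 2 :=
      sum_congr rfl fun T hT => by
        obtain rfl := (mem_powersetCard.1 hT).2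
        rw [homogeneousSum_of_card_eq, sq]
    have h3 : ∏ i ∈ range m, ((n : ℝ) - a - a - i) = (n - 2 * a).descFactorial m := by
      rw [← prod_range_cast_sub_eq_descFactorial, Nat.cast_sub ha]
      refine prod_congr rfl fun i _ => ?_
      push_cast; ring
    have h4 : ∏ i ∈ range a, ((((a + m : ℕ) : ℝ) - i) * ((n : ℝ) - (a + m : ℕ) - i)) =
        (a + m).descFactorial a * (n - (a + m)).descFactorial a := by
      rw [prod_mul_distrib, prod_range_cast_sub_eq_descFactorial,
        ← prod_range_cast_sub_eq_descFactorial (n - (a + m)), Nat.cast_sub hk]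
    have h5 : ((n - (a + m)).factorial : ℝ) * (n - 2 * a).descFactorial m =
      (n - 2 * a).factorial * (n - (a + m)).descFactorial a := by
      exact_mod_cast factorial_sub_mul_descFactorial ha hk
    have h6 : (m.factorial : ℝ) * (a + m).descFactorial a = (a + m).factorial := by
      have := Nat.factorial_mul_descFactorial (Nat.le_add_right a m)
      rw [Nat.add_sub_cancel_left] at this
      exact_mod_cast this
    have h7 : ((n - 2 * a).factorial : ℝ) * n.descFactorial (2 * a) = n.factorial := by
      exact_mod_cast Nat.factorial_mul_descFactorial ha
    have h8 : (n.choose (a + m) : ℝ) * (a + m).factorial * (n - (a + m)).factorial =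
        n.factorial := by
      exact_mod_cast Nat.choose_mul_factorial_mul_factorial hk
    simp_rw [← sq] at h1
    rw [h2, h3] at h1
    rw [h4]
    have p1 : (0 : ℝ) < n.choose (a + m) := by exact_mod_cast Nat.choose_pos hk
    have p2 : (0 : ℝ) < n.descFactorial (2 * a) := by
      exact_mod_cast Nat.descFactorial_pos.2 ha
    set A := ∑ X ∈ powersetCard (a + m) univ, homogeneousSum c a X ^ 2
    set B := ∑ S ∈ powersetCard a univ, c S ^ 2
    have hfin : (n.descFactorial (2 * a) : ℝ) * A =
        n.choose (a + m) * (B * ((a + m).descFactorial a * (n - (a + m)).descFactorial a)) := by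
      have hne : (m.factorial : ℝ) * (n - (a + m)).factorial * (n - 2 * a).factorial ≠ 0 := by
        positivity
      refine mul_left_cancel₀ hne ?_
      calc _ = ((n - 2 * a).factorial * (n.descFactorial (2 * a) : ℝ)) *
            (n - (a + m)).factorial * ((m.factorial : ℝ) * A) := by ring
        _ = n.factorial * (((n - (a + m)).factorial : ℝ) * (n - 2 * a).descFactorial m) * B := by
            rw [h7, h1]; ring
        _ = (n.choose (a + m) : ℝ) * (m.factorial * (a + m).descFactorial a) *
            (n - (a + m)).factorial *
            ((n - 2 * a).factorial * (n - (a + m)).descFactorial a) * B := by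
            rw [h5, h6, h8]
        _ = _ := by ring
    field_simp
    linarith
  -- For k < a both sides vanish: no a-subsets on the left, the factor i = k on the right.
  · rw [sum_eq_zero, mul_zero, prod_eq_zero (i := k) (by simpa using hak) (by simp), mul_zero]
    intro X hX
    rw [homogeneousSum_of_card_lt c (by rw [(mem_powersetCard.1 hX).2]; omega)]
    simp

open Finset in
theorem IsHarmonicFamily.sum_sq_eq {n t : ℕ} {c : Finset (Fin n) → ℝ}
    (hc : IsHarmonicFamily c) (ht : 2 * t ≤ n) {k : ℕ} (hk : k ≤ n) :
    (n.choose k : ℝ)⁻¹ * ∑ X ∈ powersetCard k univ,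
        (∑ a ∈ range (t + 1), homogeneousSum c a X) ^ 2 =
      ∑ a ∈ range (t + 1),
        ((n.descFactorial (2 * a) : ℝ)⁻¹ * ∑ S ∈ powersetCard a univ, c S ^ 2) *
          ∏ i ∈ range a, (((k : ℝ) - i) * ((n : ℝ) - k - i)) := by
  have h : ∑ X ∈ powersetCard k univ, (∑ a ∈ range (t + 1), homogeneousSum c a X) ^ 2 =
      ∑ a ∈ range (t + 1), ∑ X ∈ powersetCard k univ, homogeneousSum c a X ^ 2 := by
    simp_rw [sq, sum_mul_sum]
    rw [sum_comm]
    refine sum_congr rfl fun a ha => ?_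
    rw [sum_comm]
    rw [sum_eq_single_of_mem a ha]
    intro b _ hb
    exact hc.sum_homogeneousSum_mul_of_ne hb.symm k
  rw [h, mul_sum]
  refine sum_congr rfl fun a ha => hc.sum_homogeneousSum_sq ?_ hk
  have := mem_range.1 ha
  omega

/-! ### Harmonic expansions with coefficients polynomial in the cardinality -/

open Finset in
/-- Every family is the sum of a harmonic family and a family in the image of the up-operator. -/
theorem exists_isHarmonicFamily_add {n : ℕ} (c : Finset (Fin n) → ℝ) :
    ∃ h g : Finset (Fin n) → ℝ, IsHarmonicFamily h ∧
      ∀ S, c S = h S + ∑ i ∈ S, g (S.erase i) := by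
  let U : (Finset (Fin n) → ℝ) →ₗ[ℝ] EuclideanSpace ℝ (Finset (Fin n)) :=
    { toFun := fun g => WithLp.toLp 2 fun S => ∑ i ∈ S, g (S.erase i)
      map_add' := fun g g' => by
        ext S; simp [sum_add_distrib]
      map_smul' := fun r g => by
        ext S; simp [mul_sum] }
  obtain ⟨y, ⟨g, rfl⟩, z, hz, hyz⟩ :=
    (LinearMap.range U).exists_add_mem_mem_orthogonal (WithLp.toLp 2 c)
  refine ⟨fun S => z S, g, fun T => ?_, fun S => ?_⟩
  -- The orthogonal complement of the range of U is the kernel of its adjoint; pairing with the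
  -- image of the point mass at T gives harmonicity at T.
  · have h1 := (Submodule.mem_orthogonal _ _).1 hz (U (Pi.single T 1)) ⟨_, rfl⟩
    rw [PiLp.inner_apply] at h1
    have h2 : ∑ S : Finset (Fin n), ∑ i ∈ S, z S * (Pi.single T 1 : Finset (Fin n) → ℝ) (S.erase i)
        = 0 := by
      rw [← h1]
      refine sum_congr rfl fun S _ => ?_
      simp [U, mul_sum]
    rw [sum_sum_mem_eq_sum_sum_compl] at h2
    rw [← h2, sum_eq_single T]
    · refine sum_congr rfl fun i hi => ?_
      rw [erase_insert (by simpa using hi)]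
      simp
    · intro V _ hV
      refine sum_eq_zero fun i hi => ?_
      rw [erase_insert (by simpa using hi)]
      simp [hV]
    · simp
  · have := congrArg (fun v => v S) hyz
    simp [U] at this
    linarith

/-- `F` has an expansion in harmonic functions of degree at most `t` whose coefficients are
polynomials in the cardinality. -/
def HasHarmonicExpansion {n : ℕ} (t : ℕ) (F : Finset (Fin n) → ℝ) : Prop :=
  ∃ R : Finset (Fin n) → Polynomial ℝ, IsHarmonicFamily R ∧
    (∀ S, (R S).natDegree ≤ t - S.card) ∧
    ∀ X, F X = ∑ a ∈ Finset.range (t + 1),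
      homogeneousSum (fun S => (R S).eval (X.card : ℝ)) a X

open Finset in
theorem HasHarmonicExpansion.add {n t : ℕ} {F G : Finset (Fin n) → ℝ}
    (hF : HasHarmonicExpansion t F) (hG : HasHarmonicExpansion t G) :
    HasHarmonicExpansion t (F + G) := by
  obtain ⟨R, h1, h2, h3⟩ := hF
  obtain ⟨Q, k1, k2, k3⟩ := hG
  refine ⟨R + Q, fun T => ?_, fun S => ?_, fun X => ?_⟩
  · simp only [Pi.add_apply, sum_add_distrib, h1 T, k1 T, add_zero]
  · exact Polynomial.natDegree_add_le_of_degree_le (h2 S) (k2 S)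
  · simp [h3, k3, homogeneousSum, sum_add_distrib]

open Finset in
theorem HasHarmonicExpansion.smul {n t : ℕ} {F : Finset (Fin n) → ℝ} (r : ℝ)
    (hF : HasHarmonicExpansion t F) : HasHarmonicExpansion t (r • F) := by
  obtain ⟨R, h1, h2, h3⟩ := hF
  refine ⟨r • R, fun T => ?_, fun S => ?_, fun X => ?_⟩
  · simp only [Pi.smul_apply, ← smul_sum, h1 T, smul_zero]
  · exact (Polynomial.natDegree_smul_le _ _).trans (h2 S)
  · simp [h3, homogeneousSum, mul_sum]

theorem HasHarmonicExpansion.zero {n t : ℕ} :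
    HasHarmonicExpansion t (0 : Finset (Fin n) → ℝ) :=
  ⟨0, fun T => by simp, fun S => by simp, fun X => by simp [homogeneousSum]⟩

open Finset Polynomial in
-- Induction on d, peeling off the harmonic part at each degree. The vanishing for |S| > d is
-- recorded separately because the truncated d - |S| would still allow constants.
theorem exists_harmonic_expansion_homogeneousSum {n : ℕ} (d : ℕ) (c : Finset (Fin n) → ℝ) :
    ∃ R : Finset (Fin n) → ℝ[X], IsHarmonicFamily R ∧
      (∀ S, (R S).natDegree ≤ d - S.card) ∧ (∀ S, d < S.card → R S = 0) ∧
      ∀ X, homogeneousSum c d X = ∑ S ∈ X.powerset, (R S).eval (X.card : ℝ) := by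
  induction d generalizing c with
  | zero =>
    refine ⟨fun S => if S = ∅ then C (c ∅) else 0, fun T => ?_, fun S => ?_, fun S hS => ?_,
      fun X => ?_⟩
    · exact sum_eq_zero fun i _ => by simp
    · by_cases h : S = ∅ <;> simp [h]
    · exact if_neg (card_pos.1 hS).ne_empty
    · rw [sum_eq_single ∅]
      · simp [homogeneousSum]
      · intro S _ hS
        simp [hS]
      · simp
  | succ d ih =>
    obtain ⟨h, g, hh, hc⟩ := exists_isHarmonicFamily_add c
    obtain ⟨R, h1, h2, h3, h4⟩ := ih g
    refine ⟨fun S => (if S.card = d + 1 then C (h S) else 0) + (X - C (d : ℝ)) * R S,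
      fun T => ?_, fun S => ?_, fun S hS => ?_, fun Y => ?_⟩
    · have e : ∀ i ∈ Tᶜ, (if (insert i T).card = d + 1 then C (h (insert i T)) else 0 : ℝ[X]) =
          if T.card = d then C (h (insert i T)) else 0 := by
        intro i hi
        rw [card_insert_of_notMem (by simpa using hi)]
        simp
      simp only [sum_add_distrib]
      rw [← mul_sum, h1 T, mul_zero, add_zero, sum_congr rfl e]
      split_ifs
      · rw [← map_sum, hh T, map_zero]
      · simp
    · refine natDegree_add_le_of_degree_le ?_ ?_
      · split_ifs <;> simp
      · by_cases hS : d < S.card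
        · simp [h3 S hS]
        · refine natDegree_mul_le.trans ?_
          rw [natDegree_X_sub_C]
          have := h2 S
          omega
    · simp only [if_neg hS.ne', h3 S (by omega), mul_zero, add_zero]
    · have e1 : homogeneousSum c (d + 1) Y =
          homogeneousSum h (d + 1) Y + ((Y.card : ℝ) - d) * homogeneousSum g d Y := by
        unfold homogeneousSum
        rw [sum_congr rfl fun S _ => hc S, sum_add_distrib,
          sum_powersetCard_succ_sum_mem Y d (fun S i => g (S.erase i)), mul_sum]
        congr 1
        refine sum_congr rfl fun U hU => ?_
        obtain ⟨hUY, rfl⟩ := mem_powersetCard.1 hU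
        rw [← Nat.cast_sub (card_le_card hUY), ← card_sdiff_of_subset hUY, ← nsmul_eq_mul,
          ← sum_const]
        refine sum_congr rfl fun i hi => ?_
        rw [erase_insert (mem_sdiff.1 hi).2]
      rw [e1, h4]
      simp only [eval_add, eval_mul, eval_sub, eval_X, eval_C, sum_add_distrib, mul_sum]
      congr 1
      rw [homogeneousSum, powersetCard_eq_filter, sum_filter]
      refine sum_congr rfl fun S _ => ?_
      split_ifs <;> simp

open Finset in
theorem hasHarmonicExpansion_homogeneousSum {n t d : ℕ} (hd : d ≤ t) (c : Finset (Fin n) → ℝ) :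
    HasHarmonicExpansion t (homogeneousSum c d) := by
  obtain ⟨R, h1, h2, h3, h4⟩ := exists_harmonic_expansion_homogeneousSum d c
  refine ⟨R, h1, fun S => (h2 S).trans (by omega), fun Y => ?_⟩
  rw [h4]
  simp only [homogeneousSum, powersetCard_eq_filter, sum_filter]
  rw [sum_comm]
  refine sum_congr rfl fun S _ => ?_
  rw [sum_ite_eq]
  split_ifs with h
  · rfl
  -- Sets with |S| > t are missed by the sum over a, but there |S| > d, so the coefficient is zero.
  · rw [h3 S (by simp at h; omega), Polynomial.eval_zero]

/-! ### Averaging over permutations as averaging over a slice -/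

open Finset in
-- The double sum over sets Y of size |X| and permutations σ is evaluated twice: for fixed Y it does
-- not depend on Y, as a permutation carries Y to X; for fixed σ, taking preimages permutes the
-- slice.
theorem choose_inv_mul_sum_eq_sum_perm {n : ℕ} (f : Finset (Fin n) → ℝ) (X : Finset (Fin n)) :
    (n.factorial : ℝ)⁻¹ * ∑ σ : Equiv.Perm (Fin n), f (univ.filter (σ · ∈ X)) =
      (n.choose X.card : ℝ)⁻¹ * ∑ Y ∈ powersetCard X.card univ, f Y := by
  have h1 : ∀ Y ∈ powersetCard X.card univ, ∑ σ : Equiv.Perm (Fin n), f (univ.filter (σ · ∈ Y)) =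
      ∑ σ : Equiv.Perm (Fin n), f (univ.filter (σ · ∈ X)) := by
    intro Y hY
    let e : {i // i ∈ Y} ≃ {i // i ∈ X} := Finset.equivOfCardEq (mem_powersetCard.1 hY).2
    have he : ∀ i, e.extendSubtype i ∈ X ↔ i ∈ Y := fun i =>
      ⟨fun h => by_contra fun h' => e.extendSubtype_not_mem i h' h, e.extendSubtype_mem i⟩
    refine Fintype.sum_equiv (Equiv.mulLeft e.extendSubtype) _ _ fun σ => ?_
    simp [he]
  have h2 : ∀ σ : Equiv.Perm (Fin n), ∑ Y ∈ powersetCard X.card univ, f (univ.filter (σ · ∈ Y)) =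
      ∑ Y ∈ powersetCard X.card univ, f Y := by
    intro σ
    have e : ∀ Y : Finset (Fin n), univ.filter (σ · ∈ Y) = Y.map σ.symm.toEmbedding := by
      intro Y
      ext i
      simp
    refine sum_bij' (fun Y _ => Y.map σ.symm.toEmbedding) (fun Y _ => Y.map σ.toEmbedding)
      ?_ ?_ ?_ ?_ ?_
    · intro Y hY
      simpa using hY
    · intro Y hY
      simpa using hY
    · intro Y _
      ext i
      simp
    · intro Y _
      ext i
      simp
    · intro Y _
      rw [e]
  have h3 : (n.choose X.card : ℝ) * ∑ σ : Equiv.Perm (Fin n), f (univ.filter (σ · ∈ X)) =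
      n.factorial * ∑ Y ∈ powersetCard X.card univ, f Y := by
    have h := sum_comm (s := powersetCard X.card univ) (t := (univ : Finset (Equiv.Perm (Fin n))))
      (f := fun Y σ => f (univ.filter (σ · ∈ Y)))
    rw [sum_congr rfl h1, sum_congr rfl fun σ _ => h2 σ, sum_const, sum_const,
      card_powersetCard, card_univ, card_univ, Fintype.card_perm, Fintype.card_fin,
      nsmul_eq_mul, nsmul_eq_mul] at h
    exact h
  have p1 : (n.choose X.card : ℝ) ≠ 0 := by
    exact_mod_cast (Nat.choose_pos (by simpa using card_le_univ X)).ne'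
  have p2 : (n.factorial : ℝ) ≠ 0 := by positivity
  field_simp
  linarith

/-! ### Polynomials restricted to the cube -/

/-- The point of the cube `{-1, 1}ⁿ` whose negative coordinates are those in `X`. -/
def signVector {n : ℕ} (X : Finset (Fin n)) (i : Fin n) : ℝ := if i ∈ X then -1 else 1

/-- The functions on the cube given by multilinear polynomials of degree at most `t`. -/
def cubePolynomials (n t : ℕ) : Submodule ℝ (Finset (Fin n) → ℝ) :=
  Submodule.span ℝ ((fun S X => if S ⊆ X then (1 : ℝ) else 0) '' {S | S.card ≤ t})

open Finset in
theorem signVector_mul_mem_cubePolynomials {n t : ℕ} (i : Fin n) {F : Finset (Fin n) → ℝ}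
    (hF : F ∈ cubePolynomials n t) :
    (fun X => signVector X i * F X) ∈ cubePolynomials n (t + 1) := by
  induction hF using Submodule.span_induction with
  | mem F hF =>
    obtain ⟨S, hS, rfl⟩ := hF
    have hS : S.card ≤ t := hS
    -- On the cube x_i = 1 - 2·[i ∈ X], and [i ∈ X]·[S ⊆ X] = [S ∪ {i} ⊆ X].
    have h : (fun X => signVector X i * if S ⊆ X then (1 : ℝ) else 0) =
        (fun X => if S ⊆ X then (1 : ℝ) else 0) -
          (2 : ℝ) • fun X => if insert i S ⊆ X then (1 : ℝ) else 0 := by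
      ext X
      by_cases h1 : i ∈ X <;> by_cases h2 : S ⊆ X <;>
        norm_num [signVector, insert_subset_iff, h1, h2]
    rw [h]
    refine Submodule.sub_mem _ (Submodule.subset_span ⟨S, ?_, rfl⟩)
      (Submodule.smul_mem _ _ (Submodule.subset_span ⟨insert i S, ?_, rfl⟩))
    · exact hS.trans (Nat.le_succ t)
    · exact (card_insert_le i S).trans (Nat.succ_le_succ hS)
  | zero =>
    convert Submodule.zero_mem (cubePolynomials n (t + 1)) using 1
    ext X; simp
  | add F G _ _ hF hG =>
    convert Submodule.add_mem _ hF hG using 1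
    ext X; simp [mul_add]
  | smul r F _ hF =>
    convert Submodule.smul_mem _ r hF using 1
    ext X; simp [mul_left_comm]

theorem cubePolynomials_mono {n s t : ℕ} (h : s ≤ t) : cubePolynomials n s ≤ cubePolynomials n t :=
  Submodule.span_mono (Set.image_mono fun _ hS => le_trans hS h)

theorem eval_monomial_mem_cubePolynomials {n : ℕ} (a : Fin n →₀ ℕ) (r : ℝ) :
    (fun X => MvPolynomial.eval (signVector X) (MvPolynomial.monomial a r)) ∈
      cubePolynomials n (MvPolynomial.monomial a r).totalDegree := by
  refine MvPolynomial.induction_on_monomial (motive := fun p =>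
    (fun X => MvPolynomial.eval (signVector X) p) ∈ cubePolynomials n p.totalDegree) ?_ ?_ a r
  · intro r
    have h : (fun X => MvPolynomial.eval (signVector X) (MvPolynomial.C r)) =
        r • fun X : Finset (Fin n) => if ∅ ⊆ X then (1 : ℝ) else 0 := by
      ext X; simp
    rw [h]
    exact Submodule.smul_mem _ _ (Submodule.subset_span ⟨∅, by simp, rfl⟩)
  · intro p i hp
    -- The total degree rises by exactly one under multiplication by a variable only when p is
    -- nonzero.
    by_cases h0 : p = 0
    · subst h0
      simpa using hp
    · rw [MvPolynomial.totalDegree_mul_of_isDomain h0 (MvPolynomial.X_ne_zero i),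
        MvPolynomial.totalDegree_X]
      convert signVector_mul_mem_cubePolynomials i hp using 1
      ext X
      simp [mul_comm]

theorem eval_mem_cubePolynomials {n t : ℕ} (p : MvPolynomial (Fin n) ℝ) (hp : p.totalDegree ≤ t) :
    (fun X => MvPolynomial.eval (signVector X) p) ∈ cubePolynomials n t := by
  have h : (fun X => MvPolynomial.eval (signVector X) p) = ∑ a ∈ p.support,
      fun X => MvPolynomial.eval (signVector X) (MvPolynomial.monomial a (p.coeff a)) := by
    ext X
    conv_lhs => rw [p.as_sum]
    simp only [map_sum, Finset.sum_apply]
  rw [h]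
  refine Submodule.sum_mem _ fun a ha => ?_
  refine cubePolynomials_mono ?_ (eval_monomial_mem_cubePolynomials a _)
  refine le_trans ?_ ((MvPolynomial.le_totalDegree ha).trans hp)
  exact MvPolynomial.totalDegree_monomial_le _ _

open Finset in
theorem hasHarmonicExpansion_of_mem_cubePolynomials {n t : ℕ} {F : Finset (Fin n) → ℝ}
    (hF : F ∈ cubePolynomials n t) : HasHarmonicExpansion t F := by
  induction hF using Submodule.span_induction with
  | mem F hF =>
    obtain ⟨S, hS, rfl⟩ := hF
    -- The indicator of S ⊆ X is the homogeneous sum of degree |S| of the point mass at S.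
    convert hasHarmonicExpansion_homogeneousSum hS (Pi.single S 1) using 1
    ext X
    simp [homogeneousSum, Pi.single_apply]
  | zero => exact .zero
  | add F G _ _ hF hG => exact hF.add hG
  | smul r F _ hF => exact hF.smul r

open Finset in
theorem eval_symmetrization {n : ℕ} (f : MvPolynomial (Fin n) ℝ) (x : Fin n → ℝ)
    (hx : ∀ i, x i = -1 ∨ x i = 1) :
    MvPolynomial.eval x (symmetrization f) =
      (n.choose (minusCount x) : ℝ)⁻¹ * ∑ Y ∈ powersetCard (minusCount x) univ,
        MvPolynomial.eval (signVector Y) f := by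
  unfold minusCount
  rw [← choose_inv_mul_sum_eq_sum_perm]
  unfold symmetrization
  rw [MvPolynomial.smul_eval, map_sum]
  congr 1
  refine sum_congr rfl fun σ _ => ?_
  rw [MvPolynomial.eval_rename]
  congr 2
  ext i
  rcases hx (σ i) with h | h
  · simp [signVector, h]
  · norm_num [signVector, h]

/-! ### Assembling the sums of squares -/

open Finset Polynomial in
theorem isSumOfSquaresOfDegreeLE_const_mul_sum_sq {ι : Type*} (s : Finset ι) {r : ℝ} (hr : 0 ≤ r)
    {d : ℕ} (g : ι → ℝ[X]) (hg : ∀ i ∈ s, (g i).natDegree ≤ d) :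
    IsSumOfSquaresOfDegreeLE d (C r * ∑ i ∈ s, g i ^ 2) := by
  refine ⟨s.card, fun k => C (√r) * g (s.equivFin.symm k), fun k => ?_, ?_⟩
  · exact (natDegree_C_mul_le _ _).trans (hg _ (s.equivFin.symm k).2)
  · simp_rw [mul_pow, ← mul_sum]
    rw [← C_pow, Real.sq_sqrt hr]
    congr 1
    rw [← sum_coe_sort]
    exact Fintype.sum_equiv s.equivFin _ _ fun i => by simp

open Finset Polynomial in
theorem mainTheorem4 (n t : ℕ) (ht : 2 * t ≤ n) (p : MvPolynomial (Fin n) ℝ)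
    (hp : IsMultilinearPoly p) (hdeg : p.totalDegree ≤ t) :
    ∃ P : ℕ → Polynomial ℝ,
      (∀ j ∈ Finset.range (t + 1), IsSumOfSquaresOfDegreeLE (t - j) (P (t - j))) ∧
      ∀ x : Fin n → ℝ, (∀ i, x i = -1 ∨ x i = 1) →
        MvPolynomial.eval x (symmetrization (p ^ 2)) =
          ∑ j ∈ Finset.range (t + 1),
            (P (t - j)).eval (minusCount x : ℝ) *
              ∏ i ∈ Finset.range j,
                (((minusCount x : ℝ) - (i : ℝ)) * ((n : ℝ) - (minusCount x : ℝ) - (i : ℝ))) := by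
  obtain ⟨R, h1, h2, h3⟩ :=
    hasHarmonicExpansion_of_mem_cubePolynomials (eval_mem_cubePolynomials p hdeg)
  have hj : ∀ j ∈ range (t + 1), t - (t - j) = j := fun j hj => by
    have := mem_range.1 hj
    omega
  -- Here t - m is the harmonic degree a, and the constant is the one in the slice norm formula.
  refine ⟨fun m => C (n.descFactorial (2 * (t - m)) : ℝ)⁻¹ *
    ∑ S ∈ powersetCard (t - m) univ, R S ^ 2, fun j hjt => ?_, fun x hx => ?_⟩
  · simp only [hj j hjt]
    refine isSumOfSquaresOfDegreeLE_const_mul_sum_sq _ (by positivity) _ fun S hS => ?_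
    have := h2 S
    rwa [(mem_powersetCard.1 hS).2] at this
  · have hk : minusCount x ≤ n := by
      simpa [minusCount] using card_le_univ (univ.filter fun i => x i = -1)
    -- Evaluation at k is additive, so freezing the cardinality at k keeps the family harmonic, now
    -- with real coefficients.
    have hharm : IsHarmonicFamily fun S => (R S).eval (minusCount x : ℝ) := fun T => by
      have := congrArg (eval (minusCount x : ℝ)) (h1 T)
      simpa [eval_finsetSum] using this
    rw [eval_symmetrization _ x hx]
    have e : ∀ Y ∈ powersetCard (minusCount x) (univ : Finset (Fin n)),
        MvPolynomial.eval (signVector Y) (p ^ 2) =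
          (∑ a ∈ range (t + 1),
            homogeneousSum (fun S => (R S).eval (minusCount x : ℝ)) a Y) ^ 2 := by
      intro Y hY
      rw [map_pow, ← (mem_powersetCard.1 hY).2]
      exact congrArg (· ^ 2) (h3 Y)
    rw [sum_congr rfl e, hharm.sum_sq_eq ht hk]
    refine sum_congr rfl fun j hjt => ?_
    simp only [hj j hjt, eval_mul, eval_C, eval_finsetSum, eval_pow]
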